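/- Let $\mathfrak A$ be a $C^*$-algebra and let $H,K$ be Hilbert $\mathfrak A$-modules. Write $\mathcal L(H,K)$ for the adjointable operators from $H$ to $K$, $\mathcal L(H)=\mathcal L(H,H)$, and $\mathcal R(\cdot)$, $\mathcal N(\cdot)$ for range and null space. For an adjointable operator $S$ put $|S|=(S^*S)^{1/2}$; "$S=U|S|$ is the polar decomposition" means that this equation holds, with $U$ adjointable, and that $U^*U$ is the projection onto $\overline{\mathcal R(S^*)}$ (so $U$ is a partial isometry). A closed submodule $L$ of a Hilbert module $N$ is orthogonally complemented in $N$ if $N=L+L^\perp$. The reduced solution of an equation $SX=C$ (with $S$, $C$, $X$ adjointable) is the unique adjointable $D$ with $SD=C$ and $\mathcal R(D)\subseteq\overline{\mathcal R(S^*)}$, if it exists. Theorem. Suppose that $T\in\mathcal L(H,K)$ has the polar decomposition. Let $P\in\mathcal L(H)$ and $Q\in\mathcal L(K)$ be the projections onto $\overline{\mathcal R(T^*)}$ and $\overline{\mathcal R(T)}$, and put $H_1=\mathcal R(P)$, $H_2=\mathcal N(P)$, $K_1=\mathcal R(Q)$, $K_2=\mathcal N(Q)$. Let $U_P:H\to H_1\oplus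 H_2$ and $U_Q:K\to K_1\oplus K_2$ be the unitary operators $U_Px=(Px,x-Px)$ and $U_Qx=(Qx,x-Qx)$. Let $E\in\mathcal L(K)$, $F\in\mathcal L(H)$, $M=ETF^*$ and $\widetilde X=U_QMU_P^*\in\mathcal L(H_1\oplus H_2,K_1\oplus K_2)$. Put $$B=QEQ|_{K_1}\in\mathcal L(K_1),\quad C=(I-Q)EQ|_{K_1}\in\mathcal L(K_1,K_2),\quad D=PFP|_{H_1}\in\mathcal L(H_1),\quad G=(I-P)FP|_{H_1}\in\mathcal L(H_1,H_2),$$ $$A=QTP|_{H_1}\in\mathcal L(H_1,K_1),\quad \theta_{B,C}=(B^*B+C^*C)^{1/2},\quad \theta_{D,G}=(D^*D+G^*G)^{1/2},\quad Y=\theta_{B,C}\,A\,\theta_{D,G}\in\mathcal L(H_1,K_1).$$ Assume that (i) $\overline{\mathcal R(\theta_{B,C})}$ and $\overline{\mathcal R(\theta_{D,G})}$ are orthogonally complemented in $K_1$ and $H_1$, respectively; (ii) $\mathcal R(B^*),\mathcal R(C^*)\subseteq\mathcal R(\theta_{B,C})$ and $\mathcal R(D^*),\mathcal R(G^*)\subseteq\mathcal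 R(\theta_{D,G})$; (iii) $\overline{\mathcal R(Y^*)}$ and $\overline{\mathcal R(Y)}$ are orthogonally complemented in $H_1$ and $K_1$, respectively. Then $Y$ has a (unique) polar decomposition $Y=U_Y|Y|$; there are unique operators $Z_1\in\mathcal L(K_1)$, $Z_2\in\mathcal L(K_1,K_2)$, $Z_3\in\mathcal L(H_1)$, $Z_4\in\mathcal L(H_1,H_2)$ such that $Z_1^*,Z_2^*,Z_3^*,Z_4^*$ are the reduced solutions of $\theta_{B,C}X_1=B^*$, $\theta_{B,C}X_2=C^*$, $\theta_{D,G}X_3=D^*$, $\theta_{D,G}X_4=G^*$, respectively; and $\widetilde X=U_{\widetilde X}|\widetilde X|$ is the polar decomposition, where $$U_{\widetilde X}=\begin{pmatrix} Z_1U_YZ_3^* & Z_1U_YZ_4^*\\ Z_2U_YZ_3^* & Z_2U_YZ_4^*\end{pmatrix}.$$ -/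

import Mathlib

/-!
Adjointable operators on Hilbert C⋆-modules and their polar decompositions.

A Hilbert module over a (possibly non-unital) C⋆-algebra `𝔄` is a complete `CStarModule 𝔄 E`.
Mathlib lets `𝔄` act on the left, with an inner product that is linear in the second variable; these
are the same objects as right Hilbert modules over the opposite C⋆-algebra.
-/

set_option linter.unusedSectionVars false

section HilbertModules

/-! ### Adjointable operators -/

section Basic

variable (𝔄 : Type*) [NonUnitalCStarAlgebra 𝔄] [PartialOrder 𝔄] [StarOrderedRing 𝔄]
variable (E F : Type*)
  [NormedAddCommGroup E] [NormedSpace ℂ E] [SMul 𝔄 E] [CStarModule 𝔄 E]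
  [NormedAddCommGroup F] [NormedSpace ℂ F] [SMul 𝔄 F] [CStarModule 𝔄 F]

/-- The bounded operators `T : E → F` that have an adjoint with respect to the `𝔄`-valued inner
products, as a linear subspace of the bounded operators. (Maps between Hilbert modules that have an
adjoint are automatically linear and bounded.) -/
def adjointableSubmodule : Submodule ℂ (E →L[ℂ] F) where
  carrier := {T | ∃ S : F →L[ℂ] E, ∀ x y, inner 𝔄 (T x) y = inner 𝔄 x (S y)}
  add_mem' := by
    rintro T T' ⟨S, hS⟩ ⟨S', hS'⟩
    exact ⟨S + S', fun x y => by simp [hS, hS']⟩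
  zero_mem' := ⟨0, fun x y => by simp⟩
  smul_mem' := by
    rintro c T ⟨S, hS⟩
    exact ⟨star c • S, fun x y => by simp [hS]⟩

/-- The space `ℒ(E, F)` of adjointable operators from `E` to `F`, with the operator norm. -/
def AdjointableOp : Type _ := adjointableSubmodule 𝔄 E F

noncomputable instance : NormedAddCommGroup (AdjointableOp 𝔄 E F) :=
  inferInstanceAs (NormedAddCommGroup (adjointableSubmodule 𝔄 E F))

noncomputable instance : NormedSpace ℂ (AdjointableOp 𝔄 E F) :=
  inferInstanceAs (NormedSpace ℂ (adjointableSubmodule 𝔄 E F))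

end Basic

namespace AdjointableOp

section Operations

variable {𝔄 : Type*} [NonUnitalCStarAlgebra 𝔄] [PartialOrder 𝔄] [StarOrderedRing 𝔄]
variable {E F G : Type*}
  [NormedAddCommGroup E] [NormedSpace ℂ E] [SMul 𝔄 E] [CStarModule 𝔄 E]
  [NormedAddCommGroup F] [NormedSpace ℂ F] [SMul 𝔄 F] [CStarModule 𝔄 F]
  [NormedAddCommGroup G] [NormedSpace ℂ G] [SMul 𝔄 G] [CStarModule 𝔄 G]

/-- The underlying bounded operator. -/
def toCLM (T : AdjointableOp 𝔄 E F) : E →L[ℂ] F := T.1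

instance : CoeFun (AdjointableOp 𝔄 E F) (fun _ => E → F) := ⟨fun T => T.toCLM⟩

/-- An adjointable operator from a bounded operator and its adjoint. -/
def mk' (T : E →L[ℂ] F) (S : F →L[ℂ] E) (h : ∀ x y, inner 𝔄 (T x) y = inner 𝔄 x (S y)) :
    AdjointableOp 𝔄 E F := ⟨T, S, h⟩

/-- The adjoint `T*`. -/
noncomputable def adj (T : AdjointableOp 𝔄 E F) : AdjointableOp 𝔄 F E :=
  mk' T.2.choose T.1 fun x y => by
    have h := T.2.choose_spec y x
    rw [← CStarModule.star_inner, ← h, CStarModule.star_inner]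

/-- The composition `S T` of adjointable operators. -/
noncomputable def comp (S : AdjointableOp 𝔄 F G) (T : AdjointableOp 𝔄 E F) :
    AdjointableOp 𝔄 E G :=
  ⟨S.toCLM.comp T.toCLM, by
    obtain ⟨S', hS'⟩ := S.2
    obtain ⟨T', hT'⟩ := T.2
    exact ⟨T'.comp S', fun x y => (hS' (T.toCLM x) y).trans (hT' x (S' y))⟩⟩

@[ext] theorem ext {T S : AdjointableOp 𝔄 E F} (h : ∀ x, T x = S x) : T = S :=
  Subtype.ext (ContinuousLinearMap.ext h)

@[simp] theorem mk'_apply (T : E →L[ℂ] F) (S : F →L[ℂ] E)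
    (h : ∀ x y, inner 𝔄 (T x) y = inner 𝔄 x (S y)) (x : E) : mk' T S h x = T x := rfl

@[simp] theorem comp_apply (S : AdjointableOp 𝔄 F G) (T : AdjointableOp 𝔄 E F) (x : E) :
    (S.comp T) x = S (T x) := rfl

@[simp] theorem add_apply (S T : AdjointableOp 𝔄 E F) (x : E) : (S + T) x = S x + T x := rfl

@[simp] theorem smul_apply (c : ℂ) (T : AdjointableOp 𝔄 E F) (x : E) : (c • T) x = c • T x := rfl

theorem norm_def (T : AdjointableOp 𝔄 E F) : ‖T‖ = ‖T.toCLM‖ := rfl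

theorem adj_inner_right (T : AdjointableOp 𝔄 E F) (x : E) (y : F) :
    inner 𝔄 (T x) y = inner 𝔄 x (T.adj y) := T.2.choose_spec x y

theorem adj_inner_left (T : AdjointableOp 𝔄 E F) (x : F) (y : E) :
    inner 𝔄 (T.adj x) y = inner 𝔄 x (T y) := by
  rw [← CStarModule.star_inner, ← adj_inner_right, CStarModule.star_inner]

theorem eq_of_inner {x y : E} (h : ∀ z : E, inner 𝔄 z x = inner 𝔄 z y) : x = y := by
  have h0 : inner 𝔄 (x - y) (x - y) = 0 := by
    rw [CStarModule.inner_sub_right, h, sub_self]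
  exact sub_eq_zero.mp (CStarModule.inner_self.mp h0)

theorem adj_unique (T : AdjointableOp 𝔄 E F) (S : AdjointableOp 𝔄 F E)
    (h : ∀ x y, inner 𝔄 (T x) y = inner 𝔄 x (S y)) : T.adj = S :=
  ext fun y => eq_of_inner (𝔄 := 𝔄) fun x => by rw [← adj_inner_right, h]

theorem adj_adj (T : AdjointableOp 𝔄 E F) : T.adj.adj = T :=
  adj_unique _ _ fun x y => adj_inner_left T x y

theorem adj_add (S T : AdjointableOp 𝔄 E F) : (S + T).adj = S.adj + T.adj :=
  adj_unique _ _ fun x y => by simp [adj_inner_right]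

theorem adj_smul (c : ℂ) (T : AdjointableOp 𝔄 E F) : (c • T).adj = star c • T.adj :=
  adj_unique _ _ fun x y => by simp [adj_inner_right]

theorem adj_comp (S : AdjointableOp 𝔄 F G) (T : AdjointableOp 𝔄 E F) :
    (S.comp T).adj = T.adj.comp S.adj :=
  adj_unique _ _ fun x y => by simp [adj_inner_right]

theorem norm_comp_le (S : AdjointableOp 𝔄 F G) (T : AdjointableOp 𝔄 E F) :
    ‖S.comp T‖ ≤ ‖S‖ * ‖T‖ := ContinuousLinearMap.opNorm_comp_le _ _

theorem map_smul_alg (T : AdjointableOp 𝔄 E F) (a : 𝔄) (x : E) : T (a • x) = a • T x :=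
  eq_of_inner (𝔄 := 𝔄) fun z => by
    rw [← adj_inner_left, CStarModule.inner_op_smul_right, adj_inner_left,
      CStarModule.inner_op_smul_right]

theorem norm_mul_self_le_adj_comp (T : AdjointableOp 𝔄 E F) :
    ‖T‖ * ‖T‖ ≤ ‖T.adj.comp T‖ := by
  have h : ‖T‖ ≤ √‖T.adj.comp T‖ := by
    refine ContinuousLinearMap.opNorm_le_bound _ (Real.sqrt_nonneg _) fun x => ?_
    refine le_of_sq_le_sq ?_ (by positivity)
    rw [mul_pow, Real.sq_sqrt (norm_nonneg _)]
    calc ‖T x‖ ^ 2 = ‖inner 𝔄 x ((T.adj.comp T) x)‖ := by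
            rw [CStarModule.norm_sq_eq 𝔄, adj_inner_right, comp_apply]
      _ ≤ ‖x‖ * ‖(T.adj.comp T) x‖ := CStarModule.norm_inner_le E
      _ ≤ ‖x‖ * (‖T.adj.comp T‖ * ‖x‖) := by
            gcongr
            exact (T.adj.comp T).toCLM.le_opNorm x
      _ = ‖T.adj.comp T‖ * ‖x‖ ^ 2 := by ring
  calc ‖T‖ * ‖T‖ ≤ √‖T.adj.comp T‖ * √‖T.adj.comp T‖ := by gcongr
    _ = ‖T.adj.comp T‖ := Real.mul_self_sqrt (norm_nonneg _)

theorem norm_le_norm_adj (T : AdjointableOp 𝔄 E F) : ‖T‖ ≤ ‖T.adj‖ := by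
  rcases (norm_nonneg T).eq_or_lt with h | h
  · rw [← h]; exact norm_nonneg _
  · exact le_of_mul_le_mul_right ((norm_mul_self_le_adj_comp T).trans (norm_comp_le _ _)) h

theorem norm_adj (T : AdjointableOp 𝔄 E F) : ‖T.adj‖ = ‖T‖ :=
  le_antisymm ((norm_le_norm_adj T.adj).trans_eq (by rw [adj_adj])) (norm_le_norm_adj T)

instance instCompleteSpace [CompleteSpace E] [CompleteSpace F] :
    CompleteSpace (AdjointableOp 𝔄 E F) := by
  refine Metric.complete_of_cauchySeq_tendsto fun u hu => ?_
  have h1 : CauchySeq fun n => (u n).toCLM := hu.map uniformContinuous_subtype_val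
  have h2 : CauchySeq fun n => (u n).adj.toCLM := by
    rw [Metric.cauchySeq_iff] at hu ⊢
    intro ε hε
    obtain ⟨N, hN⟩ := hu ε hε
    refine ⟨N, fun m hm n hn => ?_⟩
    have h := hN m hm n hn
    rw [dist_eq_norm] at h ⊢
    have h3 : ‖(u m - u n).adj‖ = ‖(u m).adj - (u n).adj‖ := by
      congr 1
      rw [sub_eq_add_neg, adj_add, ← neg_one_smul ℂ (u n), adj_smul]
      simp [sub_eq_add_neg]
    rw [norm_adj] at h3
    exact (h3.symm.trans_lt h : ‖(u m).adj - (u n).adj‖ < ε)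
  obtain ⟨T, hT⟩ := cauchySeq_tendsto_of_complete h1
  obtain ⟨S, hS⟩ := cauchySeq_tendsto_of_complete h2
  have hTS : ∀ x y, inner 𝔄 (T x) y = inner 𝔄 x (S y) := fun x y => by
    have hx : Filter.Tendsto (fun n => (u n).toCLM x) Filter.atTop (nhds (T x)) :=
      ((ContinuousLinearMap.apply ℂ F x).continuous.tendsto T).comp hT
    have hy : Filter.Tendsto (fun n => (u n).adj.toCLM y) Filter.atTop (nhds (S y)) :=
      ((ContinuousLinearMap.apply ℂ E y).continuous.tendsto S).comp hS
    have e1 := ((CStarModule.continuous_inner (A := 𝔄) (E := F)).tendsto (T x, y)).comp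
      (hx.prodMk_nhds tendsto_const_nhds)
    have e2 := ((CStarModule.continuous_inner (A := 𝔄) (E := E)).tendsto (x, S y)).comp
      (tendsto_const_nhds.prodMk_nhds hy)
    refine tendsto_nhds_unique e1 (e2.congr fun n => ?_)
    exact (adj_inner_right (u n) x y).symm
  exact ⟨mk' T S hTS, tendsto_subtype_rng.mpr hT⟩

end Operations

/-! ### The C⋆-algebra of adjointable operators on a Hilbert module -/

section Algebra

variable {𝔄 : Type*} [NonUnitalCStarAlgebra 𝔄] [PartialOrder 𝔄] [StarOrderedRing 𝔄]
variable {E : Type*} [NormedAddCommGroup E] [NormedSpace ℂ E] [SMul 𝔄 E] [CStarModule 𝔄 E]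

noncomputable instance : Mul (AdjointableOp 𝔄 E E) := ⟨comp⟩

noncomputable instance : One (AdjointableOp 𝔄 E E) :=
  ⟨mk' (ContinuousLinearMap.id ℂ E) (ContinuousLinearMap.id ℂ E) fun _ _ => rfl⟩

noncomputable instance : Star (AdjointableOp 𝔄 E E) := ⟨adj⟩

theorem mul_def (S T : AdjointableOp 𝔄 E E) : S * T = S.comp T := rfl

theorem star_def (T : AdjointableOp 𝔄 E E) : star T = T.adj := rfl

@[simp] theorem mul_apply (S T : AdjointableOp 𝔄 E E) (x : E) : (S * T) x = S (T x) := rfl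

@[simp] theorem one_apply (x : E) : (1 : AdjointableOp 𝔄 E E) x = x := rfl

noncomputable instance : NormedRing (AdjointableOp 𝔄 E E) where
  toNorm := inferInstance
  __ := (inferInstance : NormedAddCommGroup (AdjointableOp 𝔄 E E))
  mul := (· * ·)
  one := 1
  left_distrib S T R := ext fun x => map_add S.toCLM _ _
  right_distrib _ _ _ := rfl
  zero_mul _ := rfl
  mul_zero S := ext fun x => map_zero S.toCLM
  mul_assoc _ _ _ := rfl
  one_mul _ := rfl
  mul_one _ := rfl
  norm_mul_le := norm_comp_le

noncomputable instance : NormedAlgebra ℂ (AdjointableOp 𝔄 E E) where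
  __ := (Algebra.ofModule (fun _ _ _ => rfl) (fun c S _ => ext fun _ => map_smul S.toCLM c _) :
    Algebra ℂ (AdjointableOp 𝔄 E E))
  norm_smul_le := norm_smul_le

noncomputable instance : StarRing (AdjointableOp 𝔄 E E) where
  star_involutive := adj_adj
  star_mul := adj_comp
  star_add := adj_add

instance : CStarRing (AdjointableOp 𝔄 E E) where
  norm_mul_self_le := norm_mul_self_le_adj_comp

instance : StarModule ℂ (AdjointableOp 𝔄 E E) where
  star_smul := adj_smul

noncomputable instance [CompleteSpace E] : CStarAlgebra (AdjointableOp 𝔄 E E) where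

/-- The order of the C⋆-algebra `ℒ(E)`. -/
noncomputable instance [CompleteSpace E] : PartialOrder (AdjointableOp 𝔄 E E) :=
  CStarAlgebra.spectralOrder _

instance [CompleteSpace E] : StarOrderedRing (AdjointableOp 𝔄 E E) :=
  CStarAlgebra.spectralOrderedRing _

end Algebra

/-! ### Ranges, projections, polar decompositions, reduced solutions -/

section Polar

variable {𝔄 : Type*} [NonUnitalCStarAlgebra 𝔄] [PartialOrder 𝔄] [StarOrderedRing 𝔄]
variable {E F G : Type*}
  [NormedAddCommGroup E] [NormedSpace ℂ E] [SMul 𝔄 E] [CStarModule 𝔄 E]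
  [NormedAddCommGroup F] [NormedSpace ℂ F] [SMul 𝔄 F] [CStarModule 𝔄 F]
  [NormedAddCommGroup G] [NormedSpace ℂ G] [SMul 𝔄 G] [CStarModule 𝔄 G]

/-- The range `ℛ(T)`. -/
def range (T : AdjointableOp 𝔄 E F) : Submodule ℂ F := T.toCLM.range

/-- The null space `𝒩(T)`. -/
def null (T : AdjointableOp 𝔄 E F) : Submodule ℂ E := T.toCLM.ker

/-- The closure of the range of `T`. -/
def rangeClosure (T : AdjointableOp 𝔄 E F) : Submodule ℂ F := T.range.topologicalClosure

/-- `P` is the projection of `E` onto `M`: a self-adjoint idempotent of `ℒ(E)` with range `M`. -/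
def IsProjectionOnto (P : AdjointableOp 𝔄 E E) (M : Submodule ℂ E) : Prop :=
  IsStarProjection P ∧ P.range = M

/-- The absolute value `|T| = (T* T)^{1/2}`. -/
noncomputable def abs [CompleteSpace E] (T : AdjointableOp 𝔄 E F) : AdjointableOp 𝔄 E E :=
  CFC.sqrt (T.adj.comp T)

/-- `T = U |T|` is the polar decomposition of `T`: the equation holds, and `U* U` is the projection
onto the closure of the range of `T*` (so that `U` is a partial isometry). -/
def IsPolarDecomposition [CompleteSpace E] (T U : AdjointableOp 𝔄 E F) : Prop :=
  T = U.comp T.abs ∧ (U.adj.comp U).IsProjectionOnto T.adj.rangeClosure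

/-- `T` has the polar decomposition. -/
def HasPolarDecomposition [CompleteSpace E] (T : AdjointableOp 𝔄 E F) : Prop :=
  ∃ U : AdjointableOp 𝔄 E F, T.IsPolarDecomposition U

/-- `D` is the reduced solution of the equation `A X = C`. -/
def IsReducedSolution (A : AdjointableOp 𝔄 E F) (C : AdjointableOp 𝔄 G F)
    (D : AdjointableOp 𝔄 G E) : Prop :=
  A.comp D = C ∧ D.range ≤ A.adj.rangeClosure

/-- The operator `(B* B + C* C)^{1/2}`. -/
noncomputable def theta [CompleteSpace E] (B : AdjointableOp 𝔄 E F) (C : AdjointableOp 𝔄 E G) :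
    AdjointableOp 𝔄 E E :=
  CFC.sqrt (B.adj.comp B + C.adj.comp C)

end Polar

end AdjointableOp

/-- `M` is orthogonally complemented: `E = M + M^⊥` with respect to the `𝔄`-valued inner product. -/
def IsOrthComplemented (𝔄 : Type*) [NonUnitalCStarAlgebra 𝔄] [PartialOrder 𝔄]
    {E : Type*} [NormedAddCommGroup E] [NormedSpace ℂ E] [SMul 𝔄 E] [CStarModule 𝔄 E]
    (M : Submodule ℂ E) : Prop :=
  ∀ x : E, ∃ m ∈ M, ∃ n : E, (∀ y ∈ M, inner 𝔄 n y = 0) ∧ x = m + n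

/-! ### Closed submodules as Hilbert modules -/

/-- A closed `𝔄`-submodule of `E`. -/
structure HilbertSubmodule (𝔄 : Type*) [NonUnitalCStarAlgebra 𝔄] [PartialOrder 𝔄]
    (E : Type*) [NormedAddCommGroup E] [NormedSpace ℂ E] [SMul 𝔄 E] [CStarModule 𝔄 E]
    extends Submodule ℂ E where
  alg_smul_mem' : ∀ (a : 𝔄) {x : E}, x ∈ carrier → a • x ∈ carrier
  isClosed' : IsClosed carrier

namespace HilbertSubmodule

variable {𝔄 : Type*} [NonUnitalCStarAlgebra 𝔄] [PartialOrder 𝔄]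
variable {E : Type*} [NormedAddCommGroup E] [NormedSpace ℂ E] [SMul 𝔄 E] [CStarModule 𝔄 E]

instance : CoeSort (HilbertSubmodule 𝔄 E) (Type _) := ⟨fun M => M.toSubmodule⟩

instance (M : HilbertSubmodule 𝔄 E) : SMul 𝔄 M := ⟨fun a x => ⟨a • x.1, M.alg_smul_mem' a x.2⟩⟩

/-- A closed submodule with the restricted inner product. -/
instance (M : HilbertSubmodule 𝔄 E) : CStarModule 𝔄 M where
  inner x y := inner 𝔄 x.1 y.1
  inner_add_right := CStarModule.inner_add_right
  inner_self_nonneg := CStarModule.inner_self_nonneg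
  inner_self {x} := CStarModule.inner_self.trans (Subtype.ext_iff (a1 := x) (a2 := 0)).symm
  inner_op_smul_right := CStarModule.inner_op_smul_right
  inner_smul_right_complex := CStarModule.inner_smul_right_complex
  star_inner _ _ := CStarModule.star_inner _ _
  norm_eq_sqrt_norm_inner_self x := CStarModule.norm_eq_sqrt_norm_inner_self x.1

instance [CompleteSpace E] (M : HilbertSubmodule 𝔄 E) : CompleteSpace M :=
  M.isClosed'.completeSpace_coe

end HilbertSubmodule

/-! ### Direct sums and operator matrices -/

section DirectSum

variable {𝔄 : Type*} [NonUnitalCStarAlgebra 𝔄] [PartialOrder 𝔄] [StarOrderedRing 𝔄]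
variable {E₁ E₂ F₁ F₂ : Type*}
  [NormedAddCommGroup E₁] [NormedSpace ℂ E₁] [SMul 𝔄 E₁] [CStarModule 𝔄 E₁]
  [NormedAddCommGroup E₂] [NormedSpace ℂ E₂] [SMul 𝔄 E₂] [CStarModule 𝔄 E₂]
  [NormedAddCommGroup F₁] [NormedSpace ℂ F₁] [SMul 𝔄 F₁] [CStarModule 𝔄 F₁]
  [NormedAddCommGroup F₂] [NormedSpace ℂ F₂] [SMul 𝔄 F₂] [CStarModule 𝔄 F₂]

/-- The direct sum `E₁ ⊕ E₂` of Hilbert modules, whose inner product is the sum of the inner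
products of the components. -/
abbrev DirSum (𝔄 E₁ E₂ : Type*) : Type _ := WithCStarModule 𝔄 (E₁ × E₂)

namespace AdjointableOp

/-- The bounded operator `E₁ × E₂ ≃ E₁ ⊕ E₂`. -/
noncomputable def prodEquiv (𝔄 : Type*) [NonUnitalCStarAlgebra 𝔄] [PartialOrder 𝔄]
    [StarOrderedRing 𝔄] (E₁ E₂ : Type*)
    [NormedAddCommGroup E₁] [NormedSpace ℂ E₁] [SMul 𝔄 E₁] [CStarModule 𝔄 E₁]
    [NormedAddCommGroup E₂] [NormedSpace ℂ E₂] [SMul 𝔄 E₂] [CStarModule 𝔄 E₂] :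
    DirSum 𝔄 E₁ E₂ ≃L[ℂ] E₁ × E₂ :=
  WithCStarModule.equivL ℂ

/-- The coordinate map `(x₁, x₂) ↦ x₁`; its adjoint is `x ↦ (x, 0)`. -/
noncomputable def fst : AdjointableOp 𝔄 (DirSum 𝔄 E₁ E₂) E₁ :=
  mk' ((ContinuousLinearMap.fst ℂ E₁ E₂).comp (prodEquiv 𝔄 E₁ E₂ : DirSum 𝔄 E₁ E₂ →L[ℂ] E₁ × E₂))
    (((prodEquiv 𝔄 E₁ E₂).symm : E₁ × E₂ →L[ℂ] DirSum 𝔄 E₁ E₂).comp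
      (ContinuousLinearMap.inl ℂ E₁ E₂))
    fun x y => by
      rw [WithCStarModule.prod_inner]
      change inner 𝔄 x.1 y = inner 𝔄 x.1 y + inner 𝔄 x.2 0
      rw [CStarModule.inner_zero_right, add_zero]

/-- The coordinate map `(x₁, x₂) ↦ x₂`; its adjoint is `x ↦ (0, x)`. -/
noncomputable def snd : AdjointableOp 𝔄 (DirSum 𝔄 E₁ E₂) E₂ :=
  mk' ((ContinuousLinearMap.snd ℂ E₁ E₂).comp (prodEquiv 𝔄 E₁ E₂ : DirSum 𝔄 E₁ E₂ →L[ℂ] E₁ × E₂))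
    (((prodEquiv 𝔄 E₁ E₂).symm : E₁ × E₂ →L[ℂ] DirSum 𝔄 E₁ E₂).comp
      (ContinuousLinearMap.inr ℂ E₁ E₂))
    fun x y => by
      rw [WithCStarModule.prod_inner]
      change inner 𝔄 x.2 y = inner 𝔄 x.1 0 + inner 𝔄 x.2 y
      rw [CStarModule.inner_zero_right, zero_add]

/-- The embedding `x ↦ (x, 0)`. -/
noncomputable def inl : AdjointableOp 𝔄 E₁ (DirSum 𝔄 E₁ E₂) := fst.adj

/-- The embedding `x ↦ (0, x)`. -/
noncomputable def inr : AdjointableOp 𝔄 E₂ (DirSum 𝔄 E₁ E₂) := snd.adj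

/-- The operator with the block matrix
```
( a  b )
( c  d )
```
-/
noncomputable def blockMatrix (a : AdjointableOp 𝔄 E₁ F₁) (b : AdjointableOp 𝔄 E₂ F₁)
    (c : AdjointableOp 𝔄 E₁ F₂) (d : AdjointableOp 𝔄 E₂ F₂) :
    AdjointableOp 𝔄 (DirSum 𝔄 E₁ E₂) (DirSum 𝔄 F₁ F₂) :=
  inl.comp (a.comp fst + b.comp snd) + inr.comp (c.comp fst + d.comp snd)

/-- The upper left entry of the block matrix of `W`. -/
noncomputable def entry₁₁ (W : AdjointableOp 𝔄 (DirSum 𝔄 E₁ E₂) (DirSum 𝔄 F₁ F₂)) :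
    AdjointableOp 𝔄 E₁ F₁ :=
  fst.comp (W.comp inl)

/-- The lower left entry of the block matrix of `W`. -/
noncomputable def entry₂₁ (W : AdjointableOp 𝔄 (DirSum 𝔄 E₁ E₂) (DirSum 𝔄 F₁ F₂)) :
    AdjointableOp 𝔄 E₁ F₂ :=
  snd.comp (W.comp inl)

end AdjointableOp

end DirectSum

/-! ### The decomposition given by a projection -/

/-- A projection of `ℒ(E)`. -/
structure OrthProjection (𝔄 : Type*) [NonUnitalCStarAlgebra 𝔄] [PartialOrder 𝔄]
    [StarOrderedRing 𝔄] (E : Type*) [NormedAddCommGroup E] [NormedSpace ℂ E] [SMul 𝔄 E]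
    [CStarModule 𝔄 E] where
  op : AdjointableOp 𝔄 E E
  isStarProjection : IsStarProjection op

namespace OrthProjection

variable {𝔄 : Type*} [NonUnitalCStarAlgebra 𝔄] [PartialOrder 𝔄] [StarOrderedRing 𝔄]
variable {E : Type*} [NormedAddCommGroup E] [NormedSpace ℂ E] [SMul 𝔄 E] [CStarModule 𝔄 E]
variable (P : OrthProjection 𝔄 E)

theorem op_op (x : E) : P.op (P.op x) = P.op x :=
  congrArg (fun T : AdjointableOp 𝔄 E E => T x) P.isStarProjection.isIdempotentElem

theorem op_inner (x y : E) : inner 𝔄 (P.op x) y = inner 𝔄 x (P.op y) := by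
  have h : P.op.adj = P.op := P.isStarProjection.isSelfAdjoint
  rw [AdjointableOp.adj_inner_right, h]

/-- The range of `P` as a Hilbert module. -/
def Ran : HilbertSubmodule 𝔄 E where
  toSubmodule := P.op.range
  alg_smul_mem' := by
    rintro a _ ⟨y, rfl⟩
    exact ⟨a • y, P.op.map_smul_alg a y⟩
  isClosed' := by
    have h : (P.op.range : Set E) = {x | P.op x = x} := by
      ext x
      constructor
      · rintro ⟨y, rfl⟩
        exact P.op_op y
      · intro hx
        exact ⟨x, hx⟩
    change IsClosed (P.op.range : Set E)
    rw [h]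
    exact isClosed_eq P.op.toCLM.continuous continuous_id

/-- The null space of `P` as a Hilbert module. -/
def Null : HilbertSubmodule 𝔄 E where
  toSubmodule := P.op.null
  alg_smul_mem' := by
    intro a x hx
    have hx' : P.op x = 0 := hx
    change P.op (a • x) = 0
    rw [AdjointableOp.map_smul_alg, hx']
    exact AdjointableOp.eq_of_inner (𝔄 := 𝔄) fun z => by simp
  isClosed' := P.op.toCLM.isClosed_ker

theorem sub_op_mem (x : E) : x - P.op x ∈ P.Null.toSubmodule := by
  change P.op.toCLM (x - P.op x) = 0
  rw [map_sub]
  exact sub_eq_zero.mpr (P.op_op x).symm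

theorem op_of_mem_ran {x : E} (hx : x ∈ P.Ran.toSubmodule) : P.op x = x := by
  obtain ⟨y, rfl⟩ := hx
  exact P.op_op y

/-- The unitary operator `U_P : E → ℛ(P) ⊕ 𝒩(P)`, `x ↦ (P x, x - P x)`. -/
noncomputable def split : AdjointableOp 𝔄 E (DirSum 𝔄 P.Ran P.Null) :=
  AdjointableOp.mk'
    (((AdjointableOp.prodEquiv 𝔄 P.Ran P.Null).symm :
        P.Ran × P.Null →L[ℂ] DirSum 𝔄 P.Ran P.Null).comp
      ((P.op.toCLM.codRestrict P.Ran.toSubmodule fun x => ⟨x, rfl⟩).prod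
        ((ContinuousLinearMap.id ℂ E - P.op.toCLM).codRestrict P.Null.toSubmodule P.sub_op_mem)))
    (((P.Ran.toSubmodule.subtypeL).coprod (P.Null.toSubmodule.subtypeL)).comp
      (AdjointableOp.prodEquiv 𝔄 P.Ran P.Null : DirSum 𝔄 P.Ran P.Null →L[ℂ] P.Ran × P.Null))
    fun x y => by
      rw [WithCStarModule.prod_inner]
      have e : (((P.Ran.toSubmodule.subtypeL).coprod (P.Null.toSubmodule.subtypeL)).comp
          (AdjointableOp.prodEquiv 𝔄 P.Ran P.Null : DirSum 𝔄 P.Ran P.Null →L[ℂ] P.Ran × P.Null)) y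
          = (y.1 : E) + (y.2 : E) := rfl
      rw [e]
      change inner 𝔄 (P.op x) (y.1 : E) + inner 𝔄 (x - P.op x) (y.2 : E)
        = inner 𝔄 x ((y.1 : E) + (y.2 : E))
      have h1 : P.op (y.1 : E) = y.1 := P.op_of_mem_ran y.1.2
      have h2 : P.op (y.2 : E) = 0 := y.2.2
      rw [CStarModule.inner_sub_left, op_inner, op_inner, h1, h2, CStarModule.inner_zero_right,
        sub_zero, CStarModule.inner_add_right]

end OrthProjection

end HilbertModules

/-! Write E~ = U_Q E U_Q* and F~ = U_P F U_P*. Since T maps into PH and QK on its two sides, U_Q T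
U_P* has A as its only nonzero block (`inl_comp_entry₁₁_comp_fst`). So only the first columns of E~
and F~ matter: with S = column(B, C) and R = column(D, G), the perturbation is X = S A R*.

The operators θ are the absolute values |S| and |R| (`theta_eq_abs`). The reduced solutions stack to
columns Z = (Z₁, Z₂) and W = (Z₃, Z₄) with Z|S| = S and W|R| = R, and Z*Z, W*W fix the ranges of
|S|, |R| (`adj_apply_of_isReducedSolution_abs`). Hence X = Z |S| A |R| W* = Z Y W*, where Z and W
are isometric on the ranges of Y and Y*. Such a conjugation carries Y = U|Y| to X = (Z U
W*)(W|Y|W*), again a polar decomposition (`IsPolarDecomposition.conj`), and Z U W* is the stated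
matrix.

Existence of U and of the Zᵢ rests on one construction: an operator dominated in norm by R factors
through R by extension to the closed range, and orthogonal complementedness makes this extension a
globally defined bounded map. Its adjoint comes from the symmetric construction for U, and from the
range inclusions (ii), as in Douglas' lemma, for the Zᵢ. Throughout, |S| and S* have the same closed
range (`rangeClosure_abs`), a functional calculus argument. -/

namespace AdjointableOp

/-! ### Closed ranges, projections and extension by density -/

section Algebraic

variable {𝔄 : Type*} [NonUnitalCStarAlgebra 𝔄] [PartialOrder 𝔄] [StarOrderedRing 𝔄]
variable {E F G : Type*}
  [NormedAddCommGroup E] [NormedSpace ℂ E] [SMul 𝔄 E] [CStarModule 𝔄 E]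
  [NormedAddCommGroup F] [NormedSpace ℂ F] [SMul 𝔄 F] [CStarModule 𝔄 F]
  [NormedAddCommGroup G] [NormedSpace ℂ G] [SMul 𝔄 G] [CStarModule 𝔄 G]

@[simp] theorem sub_apply (S T : AdjointableOp 𝔄 E F) (x : E) : (S - T) x = S x - T x := rfl

theorem apply_mem_range (T : AdjointableOp 𝔄 E F) (x : E) : T x ∈ T.range := ⟨x, rfl⟩

theorem apply_mem_rangeClosure (T : AdjointableOp 𝔄 E F) (x : E) : T x ∈ T.rangeClosure :=
  Submodule.le_topologicalClosure _ (T.apply_mem_range x)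

theorem rangeClosure_le_of_forall {T : AdjointableOp 𝔄 E F} {M : Submodule ℂ F}
    (hM : IsClosed (M : Set F)) (h : ∀ x, T x ∈ M) : T.rangeClosure ≤ M :=
  Submodule.topologicalClosure_minimal _ (by rintro _ ⟨x, rfl⟩; exact h x) hM

theorem isClosed_rangeClosure (T : AdjointableOp 𝔄 E F) : IsClosed (T.rangeClosure : Set F) :=
  Submodule.isClosed_topologicalClosure _

theorem continuous_inner_comp {X : Type*} [TopologicalSpace X] {f g : X → E} (hf : Continuous f)
    (hg : Continuous g) : Continuous fun x => inner 𝔄 (f x) (g x) :=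
  (CStarModule.continuous_inner (A := 𝔄) (E := E)).comp (hf.prodMk hg)

/-- An element of the closed range of `T` annihilated by `T*` vanishes. -/
theorem eq_zero_of_mem_rangeClosure {T : AdjointableOp 𝔄 E F} {y : F} (hy : y ∈ T.rangeClosure)
    (h : T.adj y = 0) : y = 0 := by
  have key : ∀ z ∈ closure (T.range : Set F), inner 𝔄 z y = 0 := by
    intro z hz
    refine closure_minimal (s := (T.range : Set F)) (t := {z | inner 𝔄 z y = 0}) ?_ ?_ hz
    · rintro _ ⟨x, rfl⟩
      exact (adj_inner_right T x y).trans (by rw [h, CStarModule.inner_zero_right])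
    · exact isClosed_eq (continuous_inner_comp continuous_id continuous_const) continuous_const
  exact CStarModule.inner_self.mp (key y hy)

/-- A pair of maps adjoint to each other, one of which is bounded, gives an adjointable operator. -/
theorem exists_of_forall_inner (f : E → F) (g : F → E) (c : ℝ) (hc : 0 ≤ c)
    (h : ∀ x y, inner 𝔄 (f x) y = inner 𝔄 x (g y)) (hg : ∀ y, ‖g y‖ ≤ c * ‖y‖) :
    ∃ T : AdjointableOp 𝔄 E F, (∀ x, T x = f x) ∧ ∀ y, T.adj y = g y := by
  have h' : ∀ x y, inner 𝔄 (g y) x = inner 𝔄 y (f x) := fun x y => by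
    rw [← CStarModule.star_inner, ← h, CStarModule.star_inner]
  -- ‖f x‖² = ‖⟨x, g (f x)⟩‖ ≤ c ‖x‖ ‖f x‖, then cancel ‖f x‖.
  have hf : ∀ x, ‖f x‖ ≤ c * ‖x‖ := fun x => by
    rcases (norm_nonneg (f x)).eq_or_lt with h0 | h0
    · rw [← h0]; positivity
    · refine le_of_mul_le_mul_right ?_ h0
      calc ‖f x‖ * ‖f x‖ = ‖inner 𝔄 x (g (f x))‖ := by
            rw [← h, ← CStarModule.norm_sq_eq 𝔄, sq]
        _ ≤ ‖x‖ * ‖g (f x)‖ := CStarModule.norm_inner_le E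
        _ ≤ ‖x‖ * (c * ‖f x‖) := by gcongr; exact hg _
        _ = c * ‖x‖ * ‖f x‖ := by ring
  let f' : E →ₗ[ℂ] F :=
    { toFun := f
      map_add' := fun x y => eq_of_inner (𝔄 := 𝔄) fun z => by
        simp [← h']
      map_smul' := fun a x => eq_of_inner (𝔄 := 𝔄) fun z => by
        simp [← h'] }
  let g' : F →ₗ[ℂ] E :=
    { toFun := g
      map_add' := fun x y => eq_of_inner (𝔄 := 𝔄) fun z => by
        simp [← h]
      map_smul' := fun a x => eq_of_inner (𝔄 := 𝔄) fun z => by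
        simp [← h] }
  refine ⟨mk' (f'.mkContinuous c hf) (g'.mkContinuous c hg) h, fun x => rfl, fun y => ?_⟩
  exact eq_of_inner (𝔄 := 𝔄) fun z => by rw [← adj_inner_right]; exact h z y

namespace IsProjectionOnto

variable {P : AdjointableOp 𝔄 E E} {M : Submodule ℂ E}

theorem adj_eq (hP : P.IsProjectionOnto M) : P.adj = P := hP.1.isSelfAdjoint

theorem apply_mem (hP : P.IsProjectionOnto M) (x : E) : P x ∈ M := hP.2 ▸ P.apply_mem_range x

theorem apply_apply (hP : P.IsProjectionOnto M) (x : E) : P (P x) = P x :=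
  congrArg (fun T : AdjointableOp 𝔄 E E => T x) hP.1.isIdempotentElem

theorem apply_of_mem (hP : P.IsProjectionOnto M) {x : E} (hx : x ∈ M) : P x = x := by
  rw [← hP.2] at hx
  obtain ⟨y, rfl⟩ := hx
  exact hP.apply_apply y

theorem of_apply (h1 : P.adj = P) (h2 : ∀ x, P x ∈ M) (h3 : ∀ x ∈ M, P x = x) :
    P.IsProjectionOnto M :=
  ⟨⟨ext fun x => h3 _ (h2 x), h1⟩, le_antisymm (by rintro _ ⟨x, rfl⟩; exact h2 x)
    fun x hx => ⟨x, h3 x hx⟩⟩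

/-- Continuous functions that agree on the range of `T` agree on the projections onto its closure. -/
theorem eq_apply {T : AdjointableOp 𝔄 F E} (hP : P.IsProjectionOnto T.rangeClosure)
    {X : Type*} [TopologicalSpace X] [T2Space X] {f g : E → X} (hf : Continuous f)
    (hg : Continuous g) (h : ∀ x, f (T x) = g (T x)) (y : E) : f (P y) = g (P y) := by
  refine closure_minimal (s := (T.range : Set E)) (t := {z | f z = g z}) ?_ (isClosed_eq hf hg)
    (hP.apply_mem y)
  rintro _ ⟨x, rfl⟩
  exact h x

/-- The difference x - P x is orthogonal to the range of T, hence killed by T*. -/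
theorem adj_apply {T : AdjointableOp 𝔄 F E} (hP : P.IsProjectionOnto T.rangeClosure) (x : E) :
    T.adj (P x) = T.adj x :=
  eq_of_inner (𝔄 := 𝔄) fun z => by
    rw [← adj_inner_right, ← adj_inner_right, ← adj_inner_left P, hP.adj_eq,
      hP.apply_of_mem (T.apply_mem_rangeClosure z)]

/-- A bounded operator dominated by `R` factors through `R` via an operator that lives on the
closure of the range of `R`. -/
theorem exists_factor [CompleteSpace G] {R : AdjointableOp 𝔄 F E}
    (hP : P.IsProjectionOnto R.rangeClosure) (S : F →L[ℂ] G) (h : ∀ x, ‖S x‖ ≤ ‖R x‖) :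
    ∃ Z : E →L[ℂ] G, (∀ x, Z (R x) = S x) ∧ ∀ y, Z (P y) = Z y := by
  let e : F →ₗ[ℂ] R.rangeClosure :=
    R.toCLM.toLinearMap.codRestrict R.rangeClosure R.apply_mem_rangeClosure
  have he : DenseRange e := by
    rintro ⟨y, hy⟩
    rw [closure_subtype]
    have : ((↑) : R.rangeClosure → E) '' Set.range e = (R.range : Set E) := by
      ext z
      constructor
      · rintro ⟨_, ⟨x, rfl⟩, rfl⟩
        exact ⟨x, rfl⟩
      · rintro ⟨x, rfl⟩
        exact ⟨e x, ⟨x, rfl⟩, rfl⟩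
    rw [this]
    exact hy
  have hS : ∃ C, ∀ x, ‖S.toLinearMap x‖ ≤ C * ‖e x‖ := ⟨1, fun x => by
    rw [one_mul]; exact h x⟩
  -- The extension by density lives only on the closed range of R; precomposing with the projection
  -- defines it on all of E, with value zero on the complement.
  let p : E →L[ℂ] R.rangeClosure := P.toCLM.codRestrict R.rangeClosure hP.apply_mem
  refine ⟨(S.toLinearMap.extendOfNorm e).comp p, fun x => ?_, fun y => ?_⟩
  · have hp : p (R x) = e x := Subtype.ext (hP.apply_of_mem (R.apply_mem_rangeClosure x))
    rw [ContinuousLinearMap.comp_apply, hp, LinearMap.extendOfNorm_eq he hS]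
    rfl
  · have hp : p (P y) = p y := Subtype.ext (hP.apply_apply y)
    rw [ContinuousLinearMap.comp_apply, hp, ContinuousLinearMap.comp_apply]

end IsProjectionOnto

/-- There is a projection onto every orthogonally complemented submodule. -/
theorem _root_.IsOrthComplemented.exists_isProjectionOnto {M : Submodule ℂ E}
    (hM : IsOrthComplemented 𝔄 M) : ∃ P : AdjointableOp 𝔄 E E, P.IsProjectionOnto M := by
  choose m hm n hn hx using hM
  have hn' : ∀ x, ∀ y ∈ M, inner 𝔄 y (n x) = 0 := fun x y hy => by
    rw [← CStarModule.star_inner, hn x y hy, star_zero]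
  have e1 : ∀ x y, inner 𝔄 (m x) y = inner 𝔄 (m x) (m y) := fun x y => by
    conv_lhs => rw [hx y, CStarModule.inner_add_right, hn' y _ (hm x), add_zero]
  have e2 : ∀ x y, inner 𝔄 x (m y) = inner 𝔄 (m x) (m y) := fun x y => by
    conv_lhs => rw [hx x, CStarModule.inner_add_left, hn x _ (hm y), add_zero]
  have hb : ∀ y, ‖m y‖ ≤ 1 * ‖y‖ := fun y => by
    rcases (norm_nonneg (m y)).eq_or_lt with h0 | h0
    · rw [← h0]; positivity
    · refine le_of_mul_le_mul_left ?_ h0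
      rw [one_mul, ← sq, CStarModule.norm_sq_eq 𝔄, ← e1]
      exact CStarModule.norm_inner_le E
  obtain ⟨P, h1, h2⟩ := exists_of_forall_inner m m 1 zero_le_one
    (fun x y => (e1 x y).trans (e2 x y).symm) hb
  refine ⟨P, .of_apply (ext fun x => by rw [h1, h2]) (fun x => by rw [h1]; exact hm x)
    fun x hx' => ?_⟩
  rw [h1]
  -- For x in M the component n x = x - m x lies in M and is orthogonal to M.
  have h0 : inner 𝔄 (n x) (n x) = 0 := by
    refine hn x _ ?_
    have := M.sub_mem hx' (hm x)
    rwa [show x - m x = n x from sub_eq_of_eq_add' (hx x)] at this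
  conv_rhs => rw [hx x, CStarModule.inner_self.mp h0, add_zero]

end Algebraic

/-! ### Positivity, absolute values and their ranges -/

section Positive

variable {𝔄 : Type*} [NonUnitalCStarAlgebra 𝔄] [PartialOrder 𝔄] [StarOrderedRing 𝔄]
variable {E F G : Type*}
  [NormedAddCommGroup E] [NormedSpace ℂ E] [SMul 𝔄 E] [CStarModule 𝔄 E] [CompleteSpace E]
  [NormedAddCommGroup F] [NormedSpace ℂ F] [SMul 𝔄 F] [CStarModule 𝔄 F]
  [NormedAddCommGroup G] [NormedSpace ℂ G] [SMul 𝔄 G] [CStarModule 𝔄 G]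

/-- Test the hypothesis on the range of the negative part b of T. As T b = -b², it gives -⟨x, b³ x⟩
≥ 0, while b³ = d* d with d = b^{1/2} b. So d = 0, and then b³, b² and b vanish in turn. -/
theorem nonneg_of_forall_inner {T : AdjointableOp 𝔄 E E} (hT : IsSelfAdjoint T)
    (h : ∀ x, 0 ≤ inner 𝔄 x (T x)) : 0 ≤ T := by
  have hb : 0 ≤ T⁻ := CFC.negPart_nonneg T
  set b := T⁻ with hbdef
  have hbs : star b = b := hb.isSelfAdjoint
  have hTb : T * b = -(b * b) := by
    conv_lhs => rw [← CFC.posPart_sub_negPart T hT, sub_mul, CFC.posPart_mul_negPart]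
    simp [hbdef]
  set d := CFC.sqrt b * b with hd
  have hds : star d * d = b * b * b := by
    have hs : star (CFC.sqrt b) = CFC.sqrt b := (CFC.sqrt_nonneg b).isSelfAdjoint
    rw [hd, star_mul, hs, hbs, mul_assoc, ← mul_assoc (CFC.sqrt b), CFC.sqrt_mul_sqrt_self b hb,
      mul_assoc]
  have hd0 : d = 0 := ext fun x => by
    have e1 : inner 𝔄 (d x) (d x) = inner 𝔄 x ((b * b * b) x) := by
      rw [adj_inner_right, ← hds]; rfl
    have e2 : inner 𝔄 (b x) (T (b x)) = -inner 𝔄 x ((b * b * b) x) := by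
      have : T (b x) = -(b (b x)) :=
        congrArg (fun T : AdjointableOp 𝔄 E E => T x) hTb
      rw [this, CStarModule.inner_neg_right, adj_inner_right, ← star_def, hbs]; rfl
    have e3 := h (b x)
    rw [e2, ← e1] at e3
    exact CStarModule.inner_self.mp
      (le_antisymm (neg_nonneg.mp e3) CStarModule.inner_self_nonneg)
  have hbb : b * b = 0 := by
    have h4 : star (b * b) * (b * b) = 0 := by
      rw [star_mul, hbs, ← mul_assoc, ← hds, hd0]; simp
    exact CStarRing.star_mul_self_eq_zero_iff _ |>.mp h4
  have hb0 : b = 0 := by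
    rw [← CStarRing.star_mul_self_eq_zero_iff, hbs, hbb]
  exact (CFC.negPart_eq_zero_iff T hT).mp hb0

/-- For S between different modules, S* S is not a priori of the form `star s * s` in ℒ(E), so
positivity is read off from ⟨x, S* S x⟩ = ⟨S x, S x⟩. -/
theorem adj_comp_self_nonneg (S : AdjointableOp 𝔄 E F) : 0 ≤ S.adj.comp S :=
  nonneg_of_forall_inner (by
    rw [isSelfAdjoint_iff, star_def, adj_comp, adj_adj]) fun x => by
    rw [comp_apply, ← adj_inner_right]
    exact CStarModule.inner_self_nonneg

theorem abs_nonneg (S : AdjointableOp 𝔄 E F) : 0 ≤ S.abs := CFC.sqrt_nonneg _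

theorem adj_abs (S : AdjointableOp 𝔄 E F) : S.abs.adj = S.abs := S.abs_nonneg.isSelfAdjoint

theorem abs_comp_abs (S : AdjointableOp 𝔄 E F) : S.abs.comp S.abs = S.adj.comp S :=
  CFC.sqrt_mul_sqrt_self _ S.adj_comp_self_nonneg

theorem abs_abs_apply (S : AdjointableOp 𝔄 E F) (x : E) : S.abs (S.abs x) = S.adj (S x) :=
  congrArg (fun T : AdjointableOp 𝔄 E E => T x) S.abs_comp_abs

theorem abs_eq {S : AdjointableOp 𝔄 E F} {R : AdjointableOp 𝔄 E E} (hR : 0 ≤ R)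
    (h : R.comp R = S.adj.comp S) : S.abs = R :=
  CFC.sqrt_unique h hR

theorem inner_abs (S : AdjointableOp 𝔄 E F) (x y : E) :
    inner 𝔄 (S.abs x) (S.abs y) = inner 𝔄 (S x) (S y) := by
  rw [adj_inner_right, adj_abs, abs_abs_apply, ← adj_inner_right]

theorem norm_abs_apply (S : AdjointableOp 𝔄 E F) (x : E) : ‖S.abs x‖ = ‖S x‖ := by
  rw [CStarModule.norm_eq_sqrt_norm_inner_self (A := 𝔄), inner_abs,
    ← CStarModule.norm_eq_sqrt_norm_inner_self]

/-- `S (S* S) ((S* S) + ε)⁻¹` approximates `S`. -/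
theorem exists_norm_sub_le (S : AdjointableOp 𝔄 E F) {ε : ℝ} (hε : 0 < ε) :
    ∃ g : AdjointableOp 𝔄 E E, ∀ x, ‖S x - S (S.adj (S (g x)))‖ ^ 2 ≤ ε * ‖x‖ ^ 2 := by
  set a := S.adj.comp S with ha
  have ha0 : 0 ≤ a := S.adj_comp_self_nonneg
  have has : IsSelfAdjoint a := ha0.isSelfAdjoint
  -- The absolute value makes f continuous on all of ℝ; it is invisible on the spectrum of a, where
  -- t ≥ 0.
  let f : ℝ → ℝ := fun t => (|t| + ε)⁻¹
  have hf : Continuous f := (continuous_abs.add continuous_const).inv₀ fun t =>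
    (add_pos_of_nonneg_of_pos (_root_.abs_nonneg t) hε).ne'
  set g := cfc f a with hg
  let k : ℝ → ℝ := fun t => 1 - t * f t
  have hk : Continuous k := continuous_const.sub (continuous_id.mul hf)
  set b := cfc k a with hb
  have hbg : b = 1 - a * g := by
    rw [hb, hg]
    change cfc (fun t => 1 - t * f t) a = _
    rw [cfc_sub (fun _ => (1 : ℝ)) (fun t => t * f t) a (by fun_prop)
      (continuous_id.mul hf).continuousOn,
      cfc_mul (fun t => t) f a (by fun_prop) hf.continuousOn, cfc_const_one ℝ a, cfc_id' ℝ a]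
  have hbs : star b = b := cfc_predicate k a
  have hbab : b * a * b = cfc (fun t => k t * t * k t) a := by
    rw [cfc_mul (fun t => k t * t) k a (hk.mul continuous_id).continuousOn hk.continuousOn,
      cfc_mul k (fun t => t) a hk.continuousOn (by fun_prop), cfc_id' ℝ a]
  -- On the spectrum b a b is t (ε/(t+ε))² = ε · t/(t+ε) · ε/(t+ε), and both fractions are at most
  -- 1.
  have hn : ‖b * a * b‖ ≤ ε := by
    rw [hbab]
    refine norm_cfc_le hε.le fun t ht => ?_
    have ht0 : 0 ≤ t := spectrum_nonneg_of_nonneg ha0 ht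
    have hkt : k t = ε / (t + ε) := by
      simp only [k, f, abs_of_nonneg ht0]
      field_simp
      ring
    rw [hkt, Real.norm_of_nonneg (by positivity)]
    have e : ε / (t + ε) * t * (ε / (t + ε)) = ε * ((t / (t + ε)) * (ε / (t + ε))) := by
      field_simp
    rw [e]
    refine mul_le_of_le_one_right hε.le (mul_le_one₀ ?_ (by positivity) ?_)
    · rw [div_le_one (by positivity)]; linarith
    · rw [div_le_one (by positivity)]; linarith
  refine ⟨g, fun x => ?_⟩
  have e : S x - S (S.adj (S (g x))) = S (b x) := by
    rw [hbg, sub_apply, map_sub]; rfl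
  rw [e, CStarModule.norm_sq_eq 𝔄]
  have e2 : inner 𝔄 (S (b x)) (S (b x)) = inner 𝔄 x ((b * a * b) x) := by
    rw [adj_inner_right, adj_inner_right b, ← star_def, hbs]; rfl
  rw [e2]
  calc _ ≤ ‖x‖ * ‖(b * a * b) x‖ := CStarModule.norm_inner_le E
    _ ≤ ‖x‖ * (ε * ‖x‖) := by
      gcongr
      exact (b * a * b).toCLM.le_of_opNorm_le hn x
    _ = ε * ‖x‖ ^ 2 := by ring

/-- For the nontrivial inclusion, S x is a limit of the vectors S S* (S (g x)) as ε → 0. -/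
theorem rangeClosure_comp_adj (S : AdjointableOp 𝔄 E F) :
    (S.comp S.adj).rangeClosure = S.rangeClosure := by
  refine le_antisymm (rangeClosure_le_of_forall S.isClosed_rangeClosure fun x =>
    S.apply_mem_rangeClosure _) (rangeClosure_le_of_forall (isClosed_rangeClosure _) fun x => ?_)
  change S x ∈ closure ((S.comp S.adj).range : Set F)
  rw [Metric.mem_closure_iff]
  intro δ hδ
  -- This ε makes the error at most δ ‖x‖ / (‖x‖ + 1) < δ; the added 1 covers x = 0.
  obtain ⟨g, hg⟩ := S.exists_norm_sub_le (ε := (δ / (‖x‖ + 1)) ^ 2) (by positivity)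
  refine ⟨_, (S.comp S.adj).apply_mem_range (S (g x)), ?_⟩
  rw [dist_eq_norm]
  have h := hg x
  rw [← mul_pow] at h
  refine (le_of_sq_le_sq h (by positivity)).trans_lt ?_
  rw [div_mul_eq_mul_div, div_lt_iff₀ (by positivity)]
  gcongr
  linarith

/-- Apply the preceding lemma to |S| and to S*: in both cases the product with the adjoint is S* S.
-/
theorem rangeClosure_abs [CompleteSpace F] (S : AdjointableOp 𝔄 E F) :
    S.abs.rangeClosure = S.adj.rangeClosure := by
  rw [← S.abs.rangeClosure_comp_adj, adj_abs, abs_comp_abs, ← S.adj.rangeClosure_comp_adj, adj_adj]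

end Positive

end AdjointableOp

namespace AdjointableOp

/-! ### Polar decompositions: uniqueness, existence, conjugation -/

section PolarDecomposition

variable {𝔄 : Type*} [NonUnitalCStarAlgebra 𝔄] [PartialOrder 𝔄] [StarOrderedRing 𝔄]
variable {E F G : Type*}
  [NormedAddCommGroup E] [NormedSpace ℂ E] [SMul 𝔄 E] [CStarModule 𝔄 E] [CompleteSpace E]
  [NormedAddCommGroup F] [NormedSpace ℂ F] [SMul 𝔄 F] [CStarModule 𝔄 F] [CompleteSpace F]
  [NormedAddCommGroup G] [NormedSpace ℂ G] [SMul 𝔄 G] [CStarModule 𝔄 G]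

/-- Equal ranges give QP = P and PQ = Q; the adjoint of the first is PQ = P. -/
theorem IsProjectionOnto.unique {P Q : AdjointableOp 𝔄 E E} {M : Submodule ℂ E}
    (hP : P.IsProjectionOnto M) (hQ : Q.IsProjectionOnto M) : P = Q :=
  ext fun x => eq_of_inner (𝔄 := 𝔄) fun z => by
    calc inner 𝔄 z (P x) = inner 𝔄 (Q (P z)) x := by
          rw [hQ.apply_of_mem (hP.apply_mem z), adj_inner_right, hP.adj_eq]
      _ = inner 𝔄 z (P (Q x)) := by
          rw [adj_inner_right, hQ.adj_eq, adj_inner_right, hP.adj_eq]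
      _ = inner 𝔄 z (Q x) := by rw [hP.apply_of_mem (hQ.apply_mem x)]

/-- If `S* S` is an idempotent, then `S S* S = S`. -/
theorem apply_adj_apply_of_isProjectionOnto {S : AdjointableOp 𝔄 E F} {M : Submodule ℂ E}
    (h : (S.adj.comp S).IsProjectionOnto M) (x : E) : S (S.adj (S x)) = S x := by
  have h1 : S.adj (S (S.adj (S x))) = S.adj (S x) := h.apply_apply x
  have h2 : S.adj (S (S.adj (S x) - x)) = 0 := by
    rw [map_sub, map_sub, h1, sub_self]
  have h3 : S (S.adj (S x) - x) = 0 := by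
    refine CStarModule.inner_self (A := 𝔄) |>.mp ?_
    rw [adj_inner_right, h2, CStarModule.inner_zero_right]
  rwa [map_sub, sub_eq_zero] at h3

namespace IsPolarDecomposition

variable {S U V : AdjointableOp 𝔄 E F}

theorem apply_abs (h : S.IsPolarDecomposition U) (x : E) : U (S.abs x) = S x :=
  (congrArg (fun T : AdjointableOp 𝔄 E F => T x) h.1).symm

theorem apply_adj_apply (h : S.IsPolarDecomposition U) (x : E) : U (U.adj (U x)) = U x :=
  apply_adj_apply_of_isProjectionOnto h.2 x

theorem isProjectionOnto_abs (h : S.IsPolarDecomposition U) :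
    (U.adj.comp U).IsProjectionOnto S.abs.rangeClosure := by
  rw [rangeClosure_abs]; exact h.2

/-- U and V agree on the closed range of |S|, and each is determined there, since U = U(U* U) and V
= V(V* V) with the same initial projection. -/
theorem unique (h : S.IsPolarDecomposition U) (h' : S.IsPolarDecomposition V) : U = V := by
  refine ext fun x => ?_
  have e := h.isProjectionOnto_abs.eq_apply U.toCLM.continuous V.toCLM.continuous
    (fun y => (h.apply_abs y).trans (h'.apply_abs y).symm) x
  have e1 : U ((U.adj.comp U) x) = U x := h.apply_adj_apply x
  have e2 : V ((V.adj.comp V) x) = V x := h'.apply_adj_apply x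
  rw [← e1, ← e2, ← h.2.unique h'.2]
  exact e

/-- Identities that hold on the range of `S` hold on the range of `U`. -/
theorem eq_apply (h : S.IsPolarDecomposition U) {X : Type*} [TopologicalSpace X] [T2Space X]
    {f g : F → X} (hf : Continuous f) (hg : Continuous g) (hfg : ∀ x, f (S x) = g (S x)) (x : E) :
    f (U x) = g (U x) := by
  rw [← h.apply_adj_apply x]
  exact h.isProjectionOnto_abs.eq_apply (hf.comp U.toCLM.continuous) (hg.comp U.toCLM.continuous)
    (fun y => by simpa only [Function.comp, ContinuousLinearMap.coe_coe, h.apply_abs] using hfg y) x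

end IsPolarDecomposition

/-- An operator `S` with complemented range closures has a polar decomposition. -/
theorem hasPolarDecomposition_of_isOrthComplemented {S : AdjointableOp 𝔄 E F}
    (h : IsOrthComplemented 𝔄 S.adj.rangeClosure) (h' : IsOrthComplemented 𝔄 S.rangeClosure) :
    S.HasPolarDecomposition := by
  rw [← rangeClosure_abs] at h
  obtain ⟨P, hP⟩ := h.exists_isProjectionOnto
  obtain ⟨Q, hQ⟩ := h'.exists_isProjectionOnto
  -- As ‖|S| x‖ = ‖S x‖, each of S and |S| factors through the other: u |S| = S and v S = |S|. The
  -- maps u and v will be U and U*.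
  obtain ⟨u, hu, huP⟩ := hP.exists_factor S.toCLM fun x => (S.norm_abs_apply x).ge
  obtain ⟨v, hv, hvQ⟩ := hQ.exists_factor S.abs.toCLM fun x => (S.norm_abs_apply x).le
  have hQu : ∀ x, Q (u x) = u x := fun x => by
    rw [← huP]
    refine hP.eq_apply (f := fun x => Q (u x)) (by fun_prop) u.continuous (fun x => ?_) x
    rw [hu]
    exact hQ.apply_of_mem (S.apply_mem_rangeClosure x)
  have hPv : ∀ x, P (v x) = v x := fun x => by
    rw [← hvQ]
    refine hQ.eq_apply (f := fun x => P (v x)) (by fun_prop) v.continuous (fun x => ?_) x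
    change P (v (S x)) = v (S x)
    rw [hv]
    exact hP.apply_of_mem (S.abs.apply_mem_rangeClosure x)
  -- By density in both variables this reduces to ⟨S a, S b⟩ = ⟨|S| a, |S| b⟩.
  have hpair : ∀ x y, inner 𝔄 (u (P x)) (Q y) = inner 𝔄 (P x) (v (Q y)) := fun x y => by
    refine hP.eq_apply (f := fun x => inner 𝔄 (u x) (Q y)) (g := fun x => inner 𝔄 x (v (Q y)))
      (continuous_inner_comp u.continuous continuous_const)
      (continuous_inner_comp continuous_id continuous_const) (fun a => ?_) x
    refine hQ.eq_apply (f := fun y => inner 𝔄 (u (S.abs a)) y)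
      (g := fun y => inner 𝔄 (S.abs a) (v y))
      (continuous_inner_comp continuous_const continuous_id)
      (continuous_inner_comp continuous_const v.continuous) (fun b => ?_) y
    rw [hu, hv]
    exact (S.inner_abs a b).symm
  have huv : ∀ x y, inner 𝔄 (u x) y = inner 𝔄 x (v y) := fun x y => by
    calc inner 𝔄 (u x) y = inner 𝔄 (Q (u (P x))) y := by rw [huP, hQu]
      _ = inner 𝔄 (u (P x)) (Q y) := by rw [adj_inner_right, hQ.adj_eq]
      _ = inner 𝔄 (P x) (v (Q y)) := hpair x y
      _ = inner 𝔄 x (v y) := by rw [adj_inner_right, hP.adj_eq, hPv, hvQ]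
  refine ⟨mk' u v huv, ext fun x => (hu x).symm, ?_⟩
  have hadj : (mk' u v huv).adj = mk' v u fun x y => by
      rw [← CStarModule.star_inner, ← huv, CStarModule.star_inner] :=
    adj_unique _ _ huv
  have hvu : (mk' u v huv).adj.comp (mk' u v huv) = P := ext fun x => by
    rw [hadj]
    change v (u x) = P x
    rw [← huP]
    refine hP.eq_apply (f := fun x => v (u x)) (g := id) (by fun_prop) continuous_id (fun a => ?_) x
    change v (u (S.abs a)) = S.abs a
    rw [hu]
    exact hv a
  rw [hvu, ← rangeClosure_abs]
  exact hP

/-- Compressing a polar decomposition by operators that are isometric on the relevant ranges. -/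
theorem IsPolarDecomposition.conj {E' F' : Type*}
    [NormedAddCommGroup E'] [NormedSpace ℂ E'] [SMul 𝔄 E'] [CStarModule 𝔄 E'] [CompleteSpace E']
    [NormedAddCommGroup F'] [NormedSpace ℂ F'] [SMul 𝔄 F'] [CStarModule 𝔄 F']
    {Y U : AdjointableOp 𝔄 E F} (h : Y.IsPolarDecomposition U)
    {Z : AdjointableOp 𝔄 F F'} {W : AdjointableOp 𝔄 E E'}
    (hZ : ∀ x, Z.adj (Z (Y x)) = Y x) (hW : ∀ y, W.adj (W (Y.adj y)) = Y.adj y) :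
    (Z.comp (Y.comp W.adj)).IsPolarDecomposition (Z.comp (U.comp W.adj)) := by
  have hZU : ∀ x, Z.adj (Z (U x)) = U x :=
    h.eq_apply (f := fun x => Z.adj (Z x)) (g := id) (by fun_prop) continuous_id hZ
  have hWM : ∀ x ∈ Y.adj.rangeClosure, W.adj (W x) = x := fun x hx => by
    have e := h.2.eq_apply (f := fun x => W.adj (W x)) (g := id) (by fun_prop) continuous_id hW x
    rwa [h.2.apply_of_mem hx] at e
  have hWabs : ∀ x, W.adj (W (Y.abs x)) = Y.abs x := fun x =>
    hWM _ (by rw [← rangeClosure_abs]; exact Y.abs.apply_mem_rangeClosure x)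
  -- W|Y|W* is positive, being R* R for R = |Y|^{1/2} W*, and its square is W Y* Y W* = (Z Y W*)* (Z
  -- Y W*).
  have habs : (Z.comp (Y.comp W.adj)).abs = W.comp (Y.abs.comp W.adj) := by
    refine abs_eq ?_ ?_
    · have hs : 0 ≤ CFC.sqrt Y.abs := CFC.sqrt_nonneg _
      have e : W.comp (Y.abs.comp W.adj)
          = ((CFC.sqrt Y.abs).comp W.adj).adj.comp ((CFC.sqrt Y.abs).comp W.adj) := by
        have hs' : (CFC.sqrt Y.abs).adj = CFC.sqrt Y.abs := hs.isSelfAdjoint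
        have hm : ∀ x, CFC.sqrt Y.abs (CFC.sqrt Y.abs x) = Y.abs x := fun x =>
          congrArg (fun T : AdjointableOp 𝔄 E E => T x)
            (CFC.sqrt_mul_sqrt_self Y.abs Y.abs_nonneg)
        rw [adj_comp, adj_adj, hs']
        exact ext fun x => congrArg W (hm _).symm
      rw [e]
      exact adj_comp_self_nonneg _
    · refine ext fun x => ?_
      simp only [adj_comp, adj_adj, comp_apply, hWabs, hZ, abs_abs_apply]
  have hcomp : (Z.comp (U.comp W.adj)).adj.comp (Z.comp (U.comp W.adj))
      = W.comp ((U.adj.comp U).comp W.adj) := ext fun x => by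
    simp only [adj_comp, adj_adj, comp_apply, hZU]
  refine ⟨?_, ?_⟩
  · rw [habs]
    refine ext fun x => ?_
    simp only [comp_apply, hWabs, h.apply_abs]
  · rw [hcomp]
    refine .of_apply ?_ (fun x => ?_) fun y hy => ?_
    · rw [adj_comp, adj_comp, adj_adj, h.2.adj_eq]; rfl
    · have hx : (U.adj.comp U) (W.adj x) ∈ closure (Y.adj.range : Set E) := h.2.apply_mem _
      change W ((U.adj.comp U) (W.adj x)) ∈ closure _
      refine map_mem_closure W.toCLM.continuous hx ?_
      rintro _ ⟨y, rfl⟩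
      -- Taking adjoints in Z* Z Y = Y gives Y* Z* Z = Y*, so W Y* y is the value of (Z Y W*)* at Z
      -- y.
      refine ⟨Z y, ?_⟩
      have e : Y.adj (Z.adj (Z y)) = Y.adj y := eq_of_inner (𝔄 := 𝔄) fun z => by
        rw [← adj_inner_right, ← adj_inner_right, ← adj_inner_left Z, hZ, adj_inner_right]
      change (Z.comp (Y.comp W.adj)).adj (Z y) = W (Y.adj y)
      simp only [adj_comp, adj_adj, comp_apply, e]
    · have hcl : IsClosed {y | (W.comp ((U.adj.comp U).comp W.adj)) y = y} :=
        isClosed_eq (ContinuousLinearMap.continuous _) continuous_id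
      refine closure_minimal (s := ((Z.comp (Y.comp W.adj)).adj.range : Set E')) ?_ hcl hy
      rintro _ ⟨y, rfl⟩
      change (W.comp ((U.adj.comp U).comp W.adj)) ((Z.comp (Y.comp W.adj)).adj y)
        = (Z.comp (Y.comp W.adj)).adj y
      have e : (U.adj.comp U) (Y.adj (Z.adj y)) = Y.adj (Z.adj y) :=
        h.2.apply_of_mem (Y.adj.apply_mem_rangeClosure _)
      rw [comp_apply] at e
      simp only [adj_comp, adj_adj, comp_apply, hW, e]

end PolarDecomposition

/-! ### Reduced solutions and Douglas' lemma -/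

section ReducedSolution

variable {𝔄 : Type*} [NonUnitalCStarAlgebra 𝔄] [PartialOrder 𝔄] [StarOrderedRing 𝔄]
variable {E F G : Type*}
  [NormedAddCommGroup E] [NormedSpace ℂ E] [SMul 𝔄 E] [CStarModule 𝔄 E]
  [NormedAddCommGroup F] [NormedSpace ℂ F] [SMul 𝔄 F] [CStarModule 𝔄 F]
  [NormedAddCommGroup G] [NormedSpace ℂ G] [SMul 𝔄 G] [CStarModule 𝔄 G]

namespace IsReducedSolution

variable {R : AdjointableOp 𝔄 E F} {S : AdjointableOp 𝔄 G F} {X X' : AdjointableOp 𝔄 G E}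

theorem apply_apply (h : R.IsReducedSolution S X) (x : G) : R (X x) = S x :=
  congrArg (fun T : AdjointableOp 𝔄 G F => T x) h.1

theorem apply_mem (h : R.IsReducedSolution S X) (x : G) : X x ∈ R.adj.rangeClosure :=
  h.2 (X.apply_mem_range x)

/-- The difference of two solutions is killed by R and lies in the closed range of R*. -/
theorem unique (h : R.IsReducedSolution S X) (h' : R.IsReducedSolution S X') : X = X' :=
  ext fun x => by
    refine sub_eq_zero.mp (eq_zero_of_mem_rangeClosure (T := R.adj)
      (Submodule.sub_mem _ (h.apply_mem x) (h'.apply_mem x)) ?_)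
    rw [adj_adj, map_sub, h.apply_apply, h'.apply_apply, sub_self]

end IsReducedSolution

/-- Douglas' lemma for an operator `S` dominated by the self-adjoint operator `R`. -/
theorem existsUnique_isReducedSolution [CompleteSpace F] {R : AdjointableOp 𝔄 E E}
    {S : AdjointableOp 𝔄 E F}
    (hR : R.adj = R) (hc : IsOrthComplemented 𝔄 R.rangeClosure) (hSR : S.adj.range ≤ R.range)
    (hn : ∀ x, ‖S x‖ ≤ ‖R x‖) :
    ∃! Z : AdjointableOp 𝔄 E F, R.IsReducedSolution S.adj Z.adj := by
  obtain ⟨P, hP⟩ := hc.exists_isProjectionOnto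
  obtain ⟨z, hz, hzP⟩ := hP.exists_factor S.toCLM hn
  -- The preimage x y is fixed only up to the kernel of R and need not be linear in y. Its
  -- projection P (x y) turns out to be adjoint to z, which forces linearity and boundedness.
  choose x hx using fun y => hSR (S.adj.apply_mem_range y)
  have hx' : ∀ y, R (x y) = S.adj y := hx
  have hpair : ∀ e y, inner 𝔄 (z e) y = inner 𝔄 e (P (x y)) := fun e y => by
    rw [← adj_inner_left P, hP.adj_eq, ← hzP]
    refine hP.eq_apply (f := fun e => inner 𝔄 (z e) y) (g := fun e => inner 𝔄 e (x y))
      (continuous_inner_comp z.continuous continuous_const)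
      (continuous_inner_comp continuous_id continuous_const) (fun a => ?_) e
    rw [hz, adj_inner_right R, hR, hx']
    exact adj_inner_right S a y
  obtain ⟨X, hX, hX'⟩ := exists_of_forall_inner (𝔄 := 𝔄) (fun y => P (x y)) z ‖z‖ (norm_nonneg _)
    (fun y e => by rw [← CStarModule.star_inner, ← hpair, CStarModule.star_inner]) z.le_opNorm
  have hred : R.IsReducedSolution S.adj X := by
    refine ⟨ext fun y => ?_, ?_⟩
    · rw [comp_apply, hX]
      have := hP.adj_apply (x y)
      rwa [hR, hx'] at this
    · rintro _ ⟨y, rfl⟩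
      rw [hR]
      change X y ∈ _
      rw [hX]
      exact hP.apply_mem _
  refine ⟨X.adj, ?_, fun Z hZ => ?_⟩
  · change R.IsReducedSolution S.adj X.adj.adj
    rwa [adj_adj]
  · rw [← adj_adj Z, IsReducedSolution.unique hZ hred]

/-- The adjoint of the reduced solution of `|S| X = S*` is isometric on the range of `|S|`. -/
theorem adj_apply_of_isReducedSolution_abs [CompleteSpace E] {S Z : AdjointableOp 𝔄 E F}
    (h : S.abs.IsReducedSolution S.adj Z.adj) :
    Z.comp S.abs = S ∧ ∀ x, Z.adj (Z (S.abs x)) = S.abs x := by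
  have h1 : Z.comp S.abs = S := by
    have := congrArg adj h.1
    rwa [adj_comp, adj_adj, adj_adj, adj_abs] at this
  refine ⟨h1, fun x => ?_⟩
  have hm : S.abs x ∈ S.abs.adj.rangeClosure := by
    rw [adj_abs]; exact S.abs.apply_mem_rangeClosure x
  -- Both vectors lie in the closed range of |S|, and |S| sends both to S* S x, because |S| Z* = S*
  -- and Z|S| = S.
  refine sub_eq_zero.mp (eq_zero_of_mem_rangeClosure (T := S.abs.adj)
    (Submodule.sub_mem _ (h.apply_mem _) hm) ?_)
  have h2 : Z (S.abs x) = S x := congrArg (fun T : AdjointableOp 𝔄 E F => T x) h1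
  rw [adj_adj, map_sub, h.apply_apply, h2, abs_abs_apply, sub_self]

end ReducedSolution

/-! ### Column operators and the operators θ -/

section Column

variable {𝔄 : Type*} [NonUnitalCStarAlgebra 𝔄] [PartialOrder 𝔄] [StarOrderedRing 𝔄]
variable {E F G E' F' G' : Type*}
  [NormedAddCommGroup E] [NormedSpace ℂ E] [SMul 𝔄 E] [CStarModule 𝔄 E]
  [NormedAddCommGroup F] [NormedSpace ℂ F] [SMul 𝔄 F] [CStarModule 𝔄 F]
  [NormedAddCommGroup G] [NormedSpace ℂ G] [SMul 𝔄 G] [CStarModule 𝔄 G]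
  [NormedAddCommGroup E'] [NormedSpace ℂ E'] [SMul 𝔄 E'] [CStarModule 𝔄 E']
  [NormedAddCommGroup F'] [NormedSpace ℂ F'] [SMul 𝔄 F'] [CStarModule 𝔄 F']
  [NormedAddCommGroup G'] [NormedSpace ℂ G'] [SMul 𝔄 G'] [CStarModule 𝔄 G']

theorem inl_apply (x : F) :
    (inl : AdjointableOp 𝔄 F (DirSum 𝔄 F G)) x = (prodEquiv 𝔄 F G).symm (x, 0) :=
  eq_of_inner (𝔄 := 𝔄) fun z => by
    rw [inl, ← adj_inner_right, WithCStarModule.prod_inner]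
    change inner 𝔄 z.1 x = inner 𝔄 z.1 x + inner 𝔄 z.2 0
    rw [CStarModule.inner_zero_right, add_zero]

theorem inr_apply (x : G) :
    (inr : AdjointableOp 𝔄 G (DirSum 𝔄 F G)) x = (prodEquiv 𝔄 F G).symm (0, x) :=
  eq_of_inner (𝔄 := 𝔄) fun z => by
    rw [inr, ← adj_inner_right, WithCStarModule.prod_inner]
    change inner 𝔄 z.2 x = inner 𝔄 z.1 0 + inner 𝔄 z.2 x
    rw [CStarModule.inner_zero_right, zero_add]

@[simp] theorem fst_inl (x : F) :
    fst ((inl : AdjointableOp 𝔄 F (DirSum 𝔄 F G)) x) = x := by rw [inl_apply]; rfl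

@[simp] theorem snd_inl (x : F) :
    snd ((inl : AdjointableOp 𝔄 F (DirSum 𝔄 F G)) x) = 0 := by rw [inl_apply]; rfl

@[simp] theorem fst_inr (x : G) :
    fst ((inr : AdjointableOp 𝔄 G (DirSum 𝔄 F G)) x) = 0 := by rw [inr_apply]; rfl

@[simp] theorem snd_inr (x : G) :
    snd ((inr : AdjointableOp 𝔄 G (DirSum 𝔄 F G)) x) = x := by rw [inr_apply]; rfl

theorem dirSum_ext {x y : DirSum 𝔄 F G} (h1 : fst x = fst y) (h2 : snd x = snd y) : x = y :=
  eq_of_inner (𝔄 := 𝔄) fun z => by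
    rw [WithCStarModule.prod_inner, WithCStarModule.prod_inner]
    exact congrArg₂ (fun a b => inner 𝔄 z.1 a + inner 𝔄 z.2 b) h1 h2

theorem inl_fst_add_inr_snd (x : DirSum 𝔄 F G) : inl (fst x) + inr (snd x) = x :=
  dirSum_ext (by simp) (by simp)

/-- The column operator `x ↦ (B x, C x)`. -/
noncomputable def column (B : AdjointableOp 𝔄 E F) (C : AdjointableOp 𝔄 E G) :
    AdjointableOp 𝔄 E (DirSum 𝔄 F G) :=
  inl.comp B + inr.comp C

theorem column_apply (B : AdjointableOp 𝔄 E F) (C : AdjointableOp 𝔄 E G) (x : E) :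
    column B C x = inl (B x) + inr (C x) := rfl

/-- Reassembles the entries 11 and 21 of a block operator `W` into its first column `W.comp inl`. -/
theorem column_fst_snd (S : AdjointableOp 𝔄 E (DirSum 𝔄 F G)) :
    column (fst.comp S) (snd.comp S) = S :=
  ext fun x => inl_fst_add_inr_snd (S x)

theorem adj_column (B : AdjointableOp 𝔄 E F) (C : AdjointableOp 𝔄 E G) :
    (column B C).adj = B.adj.comp fst + C.adj.comp snd := by
  rw [column, adj_add, adj_comp, adj_comp, inl, inr, adj_adj, adj_adj]

theorem adj_column_apply (B : AdjointableOp 𝔄 E F) (C : AdjointableOp 𝔄 E G) (x : DirSum 𝔄 F G) :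
    (column B C).adj x = B.adj (fst x) + C.adj (snd x) := by
  rw [adj_column]; rfl

theorem adj_column_comp_column (B : AdjointableOp 𝔄 E F) (C : AdjointableOp 𝔄 E G) :
    (column B C).adj.comp (column B C) = B.adj.comp B + C.adj.comp C :=
  ext fun x => by simp [adj_column_apply, column_apply]

/-- This turns each pair of equations with coefficient θ into one equation for the absolute value of
a column. -/
theorem theta_eq_abs [CompleteSpace E] (B : AdjointableOp 𝔄 E F) (C : AdjointableOp 𝔄 E G) :
    theta B C = (column B C).abs := by
  rw [theta, AdjointableOp.abs, adj_column_comp_column]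

theorem inner_theta [CompleteSpace E] (B : AdjointableOp 𝔄 E F) (C : AdjointableOp 𝔄 E G) (x : E) :
    inner 𝔄 (theta B C x) (theta B C x) = inner 𝔄 (B x) (B x) + inner 𝔄 (C x) (C x) := by
  rw [theta_eq_abs, inner_abs, WithCStarModule.prod_inner]
  have h1 : fst (column B C x) = B x := by simp [column_apply]
  have h2 : snd (column B C x) = C x := by simp [column_apply]
  exact congrArg₂ (fun a b => inner 𝔄 a a + inner 𝔄 b b) h1 h2

/-- θ² = B* B + C* C dominates B* B; this is the norm bound needed in Douglas' lemma. -/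
theorem norm_le_norm_theta_left [CompleteSpace E] (B : AdjointableOp 𝔄 E F)
    (C : AdjointableOp 𝔄 E G) (x : E) : ‖B x‖ ≤ ‖theta B C x‖ := by
  refine le_of_sq_le_sq ?_ (norm_nonneg _)
  rw [CStarModule.norm_sq_eq 𝔄, CStarModule.norm_sq_eq 𝔄, inner_theta]
  exact CStarAlgebra.norm_le_norm_of_nonneg_of_le CStarModule.inner_self_nonneg
    (le_add_of_nonneg_right CStarModule.inner_self_nonneg)

theorem norm_le_norm_theta_right [CompleteSpace E] (B : AdjointableOp 𝔄 E F)
    (C : AdjointableOp 𝔄 E G) (x : E) : ‖C x‖ ≤ ‖theta B C x‖ := by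
  refine le_of_sq_le_sq ?_ (norm_nonneg _)
  rw [CStarModule.norm_sq_eq 𝔄, CStarModule.norm_sq_eq 𝔄, inner_theta]
  exact CStarAlgebra.norm_le_norm_of_nonneg_of_le CStarModule.inner_self_nonneg
    (le_add_of_nonneg_left CStarModule.inner_self_nonneg)

theorem adj_theta [CompleteSpace E] (B : AdjointableOp 𝔄 E F) (C : AdjointableOp 𝔄 E G) :
    (theta B C).adj = theta B C := by
  rw [theta_eq_abs, adj_abs]

theorem IsReducedSolution.column {R : AdjointableOp 𝔄 E E} {B Z₁ : AdjointableOp 𝔄 E F}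
    {C Z₂ : AdjointableOp 𝔄 E G} (h₁ : R.IsReducedSolution B.adj Z₁.adj)
    (h₂ : R.IsReducedSolution C.adj Z₂.adj) :
    R.IsReducedSolution (column B C).adj (column Z₁ Z₂).adj := by
  refine ⟨ext fun x => ?_, ?_⟩
  · rw [comp_apply, adj_column_apply, adj_column_apply, map_add, h₁.apply_apply, h₂.apply_apply]
  · rintro _ ⟨x, rfl⟩
    change (AdjointableOp.column Z₁ Z₂).adj x ∈ _
    rw [adj_column_apply]
    exact Submodule.add_mem _ (h₁.apply_mem _) (h₂.apply_mem _)

theorem blockMatrix_eq_column_comp (Z₁ : AdjointableOp 𝔄 F F') (Z₂ : AdjointableOp 𝔄 F G')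
    (U : AdjointableOp 𝔄 E F) (Z₃ : AdjointableOp 𝔄 E E') (Z₄ : AdjointableOp 𝔄 E G) :
    blockMatrix (Z₁.comp (U.comp Z₃.adj)) (Z₁.comp (U.comp Z₄.adj))
      (Z₂.comp (U.comp Z₃.adj)) (Z₂.comp (U.comp Z₄.adj))
      = (column Z₁ Z₂).comp (U.comp (column Z₃ Z₄).adj) :=
  ext fun x => by simp [blockMatrix, column_apply, adj_column_apply]

end Column
end AdjointableOp

/-! ### The splitting along a projection and block forms -/

namespace OrthProjection

open AdjointableOp

variable {𝔄 : Type*} [NonUnitalCStarAlgebra 𝔄] [PartialOrder 𝔄] [StarOrderedRing 𝔄]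
variable {E F : Type*} [NormedAddCommGroup E] [NormedSpace ℂ E] [SMul 𝔄 E] [CStarModule 𝔄 E]
  [NormedAddCommGroup F] [NormedSpace ℂ F] [SMul 𝔄 F] [CStarModule 𝔄 F]
variable (P : OrthProjection 𝔄 E)

theorem adj_split_apply (x : DirSum 𝔄 P.Ran P.Null) :
    P.split.adj x = ((fst x : P.Ran) : E) + ((snd x : P.Null) : E) :=
  eq_of_inner (𝔄 := 𝔄) fun z => by
    have h1 : P.op ((fst x : P.Ran) : E) = (fst x : P.Ran) := P.op_of_mem_ran (fst x : P.Ran).2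
    have h2 : P.op ((snd x : P.Null) : E) = 0 := (snd x : P.Null).2
    rw [← adj_inner_right, WithCStarModule.prod_inner, CStarModule.inner_add_right]
    change inner 𝔄 (P.op z) ((fst x : P.Ran) : E) + inner 𝔄 (z - P.op z) ((snd x : P.Null) : E) = _
    rw [CStarModule.inner_sub_left, op_inner, op_inner, h1, h2, CStarModule.inner_zero_right,
      sub_zero]

theorem adj_split_split (x : E) : P.split.adj (P.split x) = x := by
  rw [adj_split_apply]
  exact add_sub_cancel (P.op x) x

/-- The block form of an operator with range in `P E` has vanishing second row. -/
theorem inl_fst_split {S : AdjointableOp 𝔄 F E} (h : ∀ x, P.op (S x) = S x) (x : F) :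
    inl (fst (P.split (S x))) = P.split (S x) := by
  refine dirSum_ext (fst_inl _) ?_
  rw [snd_inl]
  refine Subtype.ext ?_
  change (0 : E) = S x - P.op (S x)
  rw [h, sub_self]

end OrthProjection
open AdjointableOp

/-- The second row vanishes because T maps into QK. The second column vanishes by the same argument
applied to T*, which maps into PH; `h1` transfers it through the inner product. -/
theorem AdjointableOp.inl_comp_entry₁₁_comp_fst
    {𝔄 : Type*} [NonUnitalCStarAlgebra 𝔄] [PartialOrder 𝔄] [StarOrderedRing 𝔄]
    {H : Type*} [NormedAddCommGroup H] [NormedSpace ℂ H] [SMul 𝔄 H] [CStarModule 𝔄 H]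
    {K : Type*} [NormedAddCommGroup K] [NormedSpace ℂ K] [SMul 𝔄 K] [CStarModule 𝔄 K]
    {T : AdjointableOp 𝔄 H K} {P : OrthProjection 𝔄 H} {Q : OrthProjection 𝔄 K}
    (hP : ∀ y, P.op (T.adj y) = T.adj y) (hQ : ∀ x, Q.op (T x) = T x) :
    inl.comp ((Q.split.comp (T.comp P.split.adj)).entry₁₁.comp fst)
      = Q.split.comp (T.comp P.split.adj) := by
  have h1 : ∀ x, T (P.split.adj (inl (fst x))) = T (P.split.adj x) := fun x =>
    eq_of_inner (𝔄 := 𝔄) fun z => by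
      rw [← adj_inner_left T, ← adj_inner_left T, ← adj_inner_right P.split,
        ← adj_inner_right P.split, inl, ← adj_inner_right fst, ← adj_inner_left fst]
      exact congrArg (fun u => inner 𝔄 u x) (P.inl_fst_split hP z)
  refine ext fun x => ?_
  change inl (fst (Q.split (T (P.split.adj (inl (fst x)))))) = Q.split (T (P.split.adj x))
  rw [Q.inl_fst_split hQ, h1]

/-! ### The polar decomposition of the perturbed operator -/

theorem theorem3p6
    {𝔄 : Type*} [NonUnitalCStarAlgebra 𝔄] [PartialOrder 𝔄] [StarOrderedRing 𝔄]
    {H : Type*} [NormedAddCommGroup H] [NormedSpace ℂ H] [SMul 𝔄 H] [CStarModule 𝔄 H]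
    [CompleteSpace H]
    {K : Type*} [NormedAddCommGroup K] [NormedSpace ℂ K] [SMul 𝔄 K] [CStarModule 𝔄 K]
    [CompleteSpace K]
    (T : AdjointableOp 𝔄 H K) (hT : T.HasPolarDecomposition)
    -- the projections onto the closures of the ranges of `T*` and `T`
    (P : OrthProjection 𝔄 H) (hP : P.op.IsProjectionOnto T.adj.rangeClosure)
    (Q : OrthProjection 𝔄 K) (hQ : Q.op.IsProjectionOnto T.rangeClosure)
    -- the multiplicative perturbation `M = E T F*` and its block form `X = U_Q M U_P*`
    (E : AdjointableOp 𝔄 K K) (F : AdjointableOp 𝔄 H H)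
    (M : AdjointableOp 𝔄 H K) (hM : M = E.comp (T.comp F.adj))
    (X : AdjointableOp 𝔄 (DirSum 𝔄 P.Ran P.Null) (DirSum 𝔄 Q.Ran Q.Null))
    (hX : X = Q.split.comp (M.comp P.split.adj))
    -- the blocks of `U_Q E U_Q*`, `U_P F U_P*` and `U_Q T U_P*`
    (B : AdjointableOp 𝔄 Q.Ran Q.Ran) (hB : B = (Q.split.comp (E.comp Q.split.adj)).entry₁₁)
    (C : AdjointableOp 𝔄 Q.Ran Q.Null) (hC : C = (Q.split.comp (E.comp Q.split.adj)).entry₂₁)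
    (D : AdjointableOp 𝔄 P.Ran P.Ran) (hD : D = (P.split.comp (F.comp P.split.adj)).entry₁₁)
    (G : AdjointableOp 𝔄 P.Ran P.Null) (hG : G = (P.split.comp (F.comp P.split.adj)).entry₂₁)
    (A : AdjointableOp 𝔄 P.Ran Q.Ran) (hA : A = (Q.split.comp (T.comp P.split.adj)).entry₁₁)
    (Y : AdjointableOp 𝔄 P.Ran Q.Ran)
    (hY : Y = (AdjointableOp.theta B C).comp (A.comp (AdjointableOp.theta D G)))
    -- condition (i)
    (hBC : IsOrthComplemented 𝔄 (AdjointableOp.theta B C).rangeClosure)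
    (hDG : IsOrthComplemented 𝔄 (AdjointableOp.theta D G).rangeClosure)
    -- condition (ii)
    (hBr : B.adj.range ≤ (AdjointableOp.theta B C).range)
    (hCr : C.adj.range ≤ (AdjointableOp.theta B C).range)
    (hDr : D.adj.range ≤ (AdjointableOp.theta D G).range)
    (hGr : G.adj.range ≤ (AdjointableOp.theta D G).range)
    -- condition (iii)
    (hYa : IsOrthComplemented 𝔄 Y.adj.rangeClosure)
    (hYr : IsOrthComplemented 𝔄 Y.rangeClosure) :
    -- the polar decomposition of `Y` and the reduced solutions exist and are unique
    (∃! U : AdjointableOp 𝔄 P.Ran Q.Ran, Y.IsPolarDecomposition U) ∧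
    (∃! Z : AdjointableOp 𝔄 Q.Ran Q.Ran,
      (AdjointableOp.theta B C).IsReducedSolution B.adj Z.adj) ∧
    (∃! Z : AdjointableOp 𝔄 Q.Ran Q.Null,
      (AdjointableOp.theta B C).IsReducedSolution C.adj Z.adj) ∧
    (∃! Z : AdjointableOp 𝔄 P.Ran P.Ran,
      (AdjointableOp.theta D G).IsReducedSolution D.adj Z.adj) ∧
    (∃! Z : AdjointableOp 𝔄 P.Ran P.Null,
      (AdjointableOp.theta D G).IsReducedSolution G.adj Z.adj) ∧
    -- and they give the polar decomposition of `X`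
    ∀ (U : AdjointableOp 𝔄 P.Ran Q.Ran)
      (Z₁ : AdjointableOp 𝔄 Q.Ran Q.Ran) (Z₂ : AdjointableOp 𝔄 Q.Ran Q.Null)
      (Z₃ : AdjointableOp 𝔄 P.Ran P.Ran) (Z₄ : AdjointableOp 𝔄 P.Ran P.Null),
      Y.IsPolarDecomposition U →
      (AdjointableOp.theta B C).IsReducedSolution B.adj Z₁.adj →
      (AdjointableOp.theta B C).IsReducedSolution C.adj Z₂.adj →
      (AdjointableOp.theta D G).IsReducedSolution D.adj Z₃.adj →
      (AdjointableOp.theta D G).IsReducedSolution G.adj Z₄.adj →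
      X.IsPolarDecomposition
        (AdjointableOp.blockMatrix
          (Z₁.comp (U.comp Z₃.adj)) (Z₁.comp (U.comp Z₄.adj))
          (Z₂.comp (U.comp Z₃.adj)) (Z₂.comp (U.comp Z₄.adj))) := by
  subst hM hB hC hD hG
  have hY' := hasPolarDecomposition_of_isOrthComplemented hYa hYr
  obtain ⟨U₀, hU₀⟩ := hY'
  refine ⟨⟨U₀, hU₀, fun U hU => hU.unique hU₀⟩,
    existsUnique_isReducedSolution (adj_theta _ _) hBC hBr (norm_le_norm_theta_left _ _),
    existsUnique_isReducedSolution (adj_theta _ _) hBC hCr (norm_le_norm_theta_right _ _),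
    existsUnique_isReducedSolution (adj_theta _ _) hDG hDr (norm_le_norm_theta_left _ _),
    existsUnique_isReducedSolution (adj_theta _ _) hDG hGr (norm_le_norm_theta_right _ _), ?_⟩
  intro U Z₁ Z₂ Z₃ Z₄ hU h₁ h₂ h₃ h₄
  rw [blockMatrix_eq_column_comp]
  have hZ := h₁.column h₂
  have hW := h₃.column h₄
  -- The columns (B, C) and (D, G) become U_Q E U_Q* and U_P F U_P* restricted to the first summand,
  -- and θ their absolute values.
  simp only [entry₁₁, entry₂₁, column_fst_snd, theta_eq_abs] at hZ hW hY
  obtain ⟨hZ₁, hZ₂⟩ := adj_apply_of_isReducedSolution_abs hZ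
  obtain ⟨hW₁, hW₂⟩ := adj_apply_of_isReducedSolution_abs hW
  have hT' := inl_comp_entry₁₁_comp_fst (T := T) (P := P) (Q := Q)
    (fun y => hP.apply_of_mem (T.adj.apply_mem_rangeClosure y))
    (fun x => hQ.apply_of_mem (T.apply_mem_rangeClosure x))
  rw [← hA] at hT'
  -- Z θ and θ W* collapse to the two columns (the second one adjoint), the block form of T absorbs
  -- the embeddings, and the inner factors U_Q* U_Q and U_P* U_P cancel.
  have hXY : X = (column Z₁ Z₂).comp (Y.comp (column Z₃ Z₄).adj) := by
    have hW₁' := congrArg adj hW₁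
    rw [adj_comp, adj_abs] at hW₁'
    refine ext fun x => ?_
    have e1 := fun x => congrArg (fun S : AdjointableOp _ _ _ => S x) hZ₁
    have e2 := congrArg (fun S : AdjointableOp _ _ _ => S x) hW₁'
    have e3 := fun x => congrArg (fun S : AdjointableOp _ _ _ => S x) hT'
    simp only [adj_comp, adj_adj, comp_apply, inl] at e1 e2 e3
    simp only [hX, hY, comp_apply, e1, e2, e3, OrthProjection.adj_split_split, inl]
  rw [hXY]
  -- Y begins with θ_{B,C} and Y* with θ_{D,G}, so their ranges lie where Z* Z and W* W act as the
  -- identity.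
  refine hU.conj (fun x => ?_) (fun y => ?_)
  · rw [hY]
    exact hZ₂ _
  · rw [hY]
    simp only [adj_comp, adj_abs, comp_apply]
    exact hW₂ _
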